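/- Let $\theta_3(x)=\sum_{n=-\infty}^{\infty}e^{-\pi n^2x}$ for $\operatorname{Re}x>0$, let $$\sigma_3(z)=\frac{1}{\sqrt{1+z}}\,\theta_3\!\left(\frac{1-z}{1+z}\right)\qquad(|z|<1)$$ (principal branch of the square root), and let $\Phi=\dfrac{\Gamma(1/4)^8}{128\,\pi^4}$. For $n\ge 0$ define $$d(n)=\frac{\sigma_3^{(2n)}(0)}{\theta_3(1)\,\Phi^n}.$$ Then $\sigma_3$ has the expansion $$\sigma_3(z)=\theta_3(1)\sum_{n=0}^\infty\frac{d(n)}{(2n)!}\,\Phi^n z^{2n}\qquad(|z|<1),$$ and $d(n)$ is an integer for every $n\ge 0$. -/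

import Mathlib

open Complex

noncomputable section

/-- The Jacobi theta constant `θ₃(x) = ∑_{n ∈ ℤ} exp (-π n² x)`, for `Re x > 0`. -/
def theta3 (x : ℂ) : ℂ := ∑' n : ℤ, Complex.exp (-(Real.pi : ℂ) * (n : ℂ) ^ 2 * x)

/-- The centered theta function `σ₃(z) = (1 + z)^(-1/2) θ₃((1 - z) / (1 + z))`, for `|z| < 1`.
The power is the principal one; `Re (1 + z) > 0` on the unit disk. -/
def sigma3 (z : ℂ) : ℂ := 1 / (1 + z) ^ (1 / 2 : ℂ) * theta3 ((1 - z) / (1 + z))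

/-- The constant `Ω = Γ(1/4)⁸ / (32 π⁴)`. -/
def OmegaConst : ℝ := Real.Gamma (1 / 4) ^ 8 / (32 * Real.pi ^ 4)

/-- The constant `Φ = Ω / 4 = Γ(1/4)⁸ / (128 π⁴)`. -/
def PhiConst : ℝ := OmegaConst / 4

/-- The normalized Taylor coefficient `d(n)` of `σ₃` at `0`: the number for which the coefficient
of `z^(2n)` in the Taylor series, `σ₃^(2n)(0) / (2n)!`, equals `θ₃(1) d(n) Φⁿ / (2n)!`. -/
def dCoeff (n : ℕ) : ℂ := iteratedDeriv (2 * n) sigma3 0 / (theta3 1 * (PhiConst : ℂ) ^ n)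

end

/-! In the nome q = exp(-πx), θ₃ and θ₄ are the values of one series at q and -q. On the disk, σ₃²,
its θ₄ analogue and the logarithmic derivative of σ₃² satisfy a closed polynomial differential
system (`hasDerivAt_sigmaSq`, `hasDerivAt_sigmaFourSq`, `hasDerivAt_sigmaLog`). Evenness of σ₃,
which is the inversion x ↦ 1/x, fixes the initial data up to scale: the logarithmic derivative
vanishes at 0 and θ₃⁴ = 2θ₄⁴ there. After rescaling, the system has coefficients in kℤ with k =
πθ₃(1)⁴/2 and initial values 1, 1, 0, so the n-th derivative of σ₃² at 0 lies in θ₃(1)²kⁿℤ.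

Since k² = 2Φ, the even derivatives carry an extra 2ⁿ. This pays for the division by 2 when d(n) is
extracted from the convolution expressing σ₃² through σ₃ (`exists_int_of_sum_choose_mul`).

The differential equations come from two quadratic identities relating q to q², and the principle
that a function invariant under q ↦ q² equals its limit at 0. The value Φ = π²θ₃(1)⁸/8 comes from
the same identities read as a step of the arithmetic-geometric mean, together with the lemniscatic
integral. -/

/-! ### The theta series as an analytic function of the nome -/

/-- The theta series `∑_{n ∈ ℤ} q^(n²)` in the nome `q`. -/
noncomputable def thetaQ (q : ℂ) : ℂ := ∑' n : ℤ, q ^ (n.natAbs ^ 2)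

lemma summable_pow_natAbs_sq {r : ℝ} (h0 : 0 ≤ r) (h1 : r < 1) :
    Summable (fun n : ℤ => r ^ (n.natAbs ^ 2)) := by
  have hg := summable_geometric_of_lt_one h0 h1
  have : Summable (fun n : ℤ => r ^ n.natAbs) := by
    apply Summable.of_nat_of_neg <;> simpa using hg
  refine this.of_nonneg_of_le (fun n => by positivity) fun n => ?_
  exact pow_le_pow_of_le_one h0 h1.le (by nlinarith [n.natAbs.le_mul_self])

lemma differentiableOn_thetaQ : DifferentiableOn ℂ thetaQ (Metric.ball 0 1) := by
  intro q hq
  obtain ⟨r, hr, hr1⟩ := exists_between (mem_ball_zero_iff.mp hq)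
  have h : DifferentiableOn ℂ thetaQ (Metric.ball 0 r) := by
    refine differentiableOn_tsum_of_summable_norm
      (summable_pow_natAbs_sq ((norm_nonneg q).trans hr.le) hr1) (fun n => by fun_prop)
      Metric.isOpen_ball fun n w hw => ?_
    rw [norm_pow]
    exact pow_le_pow_left₀ (norm_nonneg w) (mem_ball_zero_iff.mp hw).le _
  exact (h.differentiableAt (Metric.isOpen_ball.mem_nhds
    (mem_ball_zero_iff.mpr hr))).differentiableWithinAt

lemma analyticAt_thetaQ {q : ℂ} (hq : ‖q‖ < 1) : AnalyticAt ℂ thetaQ q :=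
  differentiableOn_thetaQ.analyticAt (Metric.isOpen_ball.mem_nhds (mem_ball_zero_iff.mpr hq))

lemma thetaQ_zero : thetaQ 0 = 1 := by
  rw [thetaQ, tsum_eq_single 0]
  · simp
  · intro n hn
    simp [hn]

lemma deriv_thetaQ_zero : deriv thetaQ 0 = 2 := by
  have h := hasSum_deriv_of_summable_norm (F := fun (n : ℤ) (q : ℂ) => q ^ (n.natAbs ^ 2))
    (U := Metric.ball 0 (1 / 2)) (z := 0)
    (summable_pow_natAbs_sq (r := 1 / 2) (by norm_num) (by norm_num)) (fun n => by fun_prop)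
    Metric.isOpen_ball (fun n w hw => by
      rw [norm_pow]
      exact pow_le_pow_left₀ (norm_nonneg w) (mem_ball_zero_iff.mp hw).le _) (by simp)
  have h2 : HasSum (fun n : ℤ => deriv (fun q : ℂ => q ^ (n.natAbs ^ 2)) 0)
      (∑ n ∈ ({1, -1} : Finset ℤ), deriv (fun q : ℂ => q ^ (n.natAbs ^ 2)) 0) := by
    refine hasSum_sum_of_ne_finset_zero fun n hn => ?_
    simp only [Finset.mem_insert, Finset.mem_singleton, not_or] at hn
    rcases eq_or_ne n 0 with rfl | h0
    · simp
    · have : n.natAbs ^ 2 - 1 ≠ 0 := by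
        have : 2 ≤ n.natAbs := by omega
        have : 4 ≤ n.natAbs ^ 2 := by nlinarith
        omega
      simp [this]
  have := h.unique h2
  rw [show thetaQ = fun w => ∑' n : ℤ, w ^ (n.natAbs ^ 2) from rfl, this]
  rw [Finset.sum_pair (by norm_num)]
  simp
  norm_num

/-! ### Quadratic relations between θ₃ and θ₄ -/

/-- The map (u, v) ↦ (u + v, u - v) is a bijection of ℤ² onto the index-two sublattice of pairs with
even sum. -/
lemma tsum_int_prod_eq_of_even_support {F : ℤ × ℤ → ℂ}
    (h : ∀ p : ℤ × ℤ, ¬ Even (p.1 + p.2) → F p = 0) :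
    ∑' p : ℤ × ℤ, F p = ∑' p : ℤ × ℤ, F (p.1 + p.2, p.1 - p.2) := by
  have hinj : Function.Injective (fun p : ℤ × ℤ => (p.1 + p.2, p.1 - p.2)) := by
    rintro ⟨a, b⟩ ⟨c, d⟩ h
    simp only [Prod.mk.injEq] at h ⊢
    omega
  refine (hinj.tsum_eq fun p hp => ?_).symm
  have he : Even (p.1 + p.2) := by
    by_contra hc
    exact hp (h p hc)
  obtain ⟨k, hk⟩ := he
  refine ⟨(k, p.1 - k), ?_⟩
  ext <;> simp
  omega

lemma natAbs_sq_add_natAbs_sq (u v : ℤ) :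
    (u + v).natAbs ^ 2 + (u - v).natAbs ^ 2 = 2 * (u.natAbs ^ 2 + v.natAbs ^ 2) := by
  zify
  simp only [sq_abs]
  ring

lemma neg_one_pow_natAbs_sq (n : ℤ) : (-1 : ℂ) ^ (n.natAbs ^ 2) = (-1) ^ n.natAbs := by
  rcases Nat.even_or_odd n.natAbs with h | h
  · rw [h.neg_one_pow, (h.pow_of_ne_zero two_ne_zero).neg_one_pow]
  · rw [h.neg_one_pow, h.pow.neg_one_pow]

lemma hasSum_thetaQ_mul {q r : ℂ} (hq : ‖q‖ < 1) (hr : ‖r‖ < 1) :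
    HasSum (fun p : ℤ × ℤ => q ^ (p.1.natAbs ^ 2) * r ^ (p.2.natAbs ^ 2))
      (thetaQ q * thetaQ r) := by
  have h1 := summable_pow_natAbs_sq (norm_nonneg q) hq
  have h2 := summable_pow_natAbs_sq (norm_nonneg r) hr
  simp only [← norm_pow] at h1 h2
  rw [thetaQ, thetaQ, tsum_mul_tsum_of_summable_norm h1 h2]
  exact (summable_mul_of_summable_norm h1 h2).hasSum

lemma norm_sq_lt_one {q : ℂ} (hq : ‖q‖ < 1) : ‖q ^ 2‖ < 1 := by
  rw [norm_pow]
  exact pow_lt_one₀ (norm_nonneg q) hq two_ne_zero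

lemma even_add_iff_natAbs (m n : ℤ) : Even (m + n) ↔ Even (m.natAbs + n.natAbs) := by
  rw [Int.even_add, Nat.even_add, Int.natAbs_even, Int.natAbs_even]

/-- In the double series, terms with m + n odd cancel between the two squares; on the rest, (u + v)²
+ (u - v)² = 2(u² + v²). -/
lemma thetaQ_sq_add_thetaQ_neg_sq {q : ℂ} (hq : ‖q‖ < 1) :
    thetaQ q ^ 2 + thetaQ (-q) ^ 2 = 2 * thetaQ (q ^ 2) ^ 2 := by
  have hn : ‖-q‖ < 1 := by simpa
  have h := (hasSum_thetaQ_mul hq hq).add (hasSum_thetaQ_mul hn hn)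
  have h2 := (hasSum_thetaQ_mul (norm_sq_lt_one hq) (norm_sq_lt_one hq)).mul_left 2
  rw [sq, sq, sq, ← h.tsum_eq, ← h2.tsum_eq]
  rw [tsum_int_prod_eq_of_even_support]
  · refine tsum_congr fun p => ?_
    simp only [neg_pow q, neg_one_pow_natAbs_sq]
    have h1 : (-1 : ℂ) ^ (p.1 + p.2).natAbs * (-1) ^ (p.1 - p.2).natAbs = 1 := by
      rw [← pow_add]
      exact ((even_add_iff_natAbs _ _).mp ⟨p.1, by ring⟩).neg_one_pow
    have h3 := natAbs_sq_add_natAbs_sq p.1 p.2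
    calc _ = q ^ ((p.1 + p.2).natAbs ^ 2 + (p.1 - p.2).natAbs ^ 2) *
          (1 + (-1 : ℂ) ^ (p.1 + p.2).natAbs * (-1) ^ (p.1 - p.2).natAbs) := by ring
      _ = _ := by rw [h1, h3]; ring
  · intro p hp
    simp only [neg_pow q, neg_one_pow_natAbs_sq]
    have h1 : (-1 : ℂ) ^ p.1.natAbs * (-1) ^ p.2.natAbs = -1 := by
      rw [← pow_add]
      rw [even_add_iff_natAbs, Nat.not_even_iff_odd] at hp
      exact hp.neg_one_pow
    linear_combination q ^ (p.1.natAbs ^ 2) * q ^ (p.2.natAbs ^ 2) * h1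

lemma thetaQ_mul_thetaQ_neg {q : ℂ} (hq : ‖q‖ < 1) :
    thetaQ q * thetaQ (-q) = thetaQ (-q ^ 2) ^ 2 := by
  have hn : ‖-q‖ < 1 := by simpa
  have h := (hasSum_thetaQ_mul hq hn).add (hasSum_thetaQ_mul hn hq)
  have hq2 : ‖-q ^ 2‖ < 1 := by simpa using norm_sq_lt_one hq
  have h2 := (hasSum_thetaQ_mul hq2 hq2).mul_left 2
  -- Symmetrising the product makes the terms with m + n odd cancel.
  suffices thetaQ q * thetaQ (-q) + thetaQ (-q) * thetaQ q =
      2 * (thetaQ (-q ^ 2) * thetaQ (-q ^ 2)) by linear_combination this / 2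
  rw [← h.tsum_eq, ← h2.tsum_eq]
  rw [tsum_int_prod_eq_of_even_support]
  · refine tsum_congr fun p => ?_
    simp only [neg_pow q, neg_pow (q ^ 2), neg_one_pow_natAbs_sq]
    have h1 : (-1 : ℂ) ^ (p.1 + p.2).natAbs = (-1) ^ (p.1.natAbs) * (-1) ^ p.2.natAbs := by
      rw [← pow_add, neg_one_pow_eq_pow_mod_two, neg_one_pow_eq_pow_mod_two (p.1.natAbs + _)]
      congr 1; omega
    have h2 : (-1 : ℂ) ^ (p.1 - p.2).natAbs = (-1) ^ (p.1.natAbs) * (-1) ^ p.2.natAbs := by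
      rw [← pow_add, neg_one_pow_eq_pow_mod_two, neg_one_pow_eq_pow_mod_two (p.1.natAbs + _)]
      congr 1; omega
    have h3 := natAbs_sq_add_natAbs_sq p.1 p.2
    calc _ = q ^ ((p.1 + p.2).natAbs ^ 2 + (p.1 - p.2).natAbs ^ 2) *
          ((-1 : ℂ) ^ (p.1 - p.2).natAbs + (-1) ^ (p.1 + p.2).natAbs) := by ring
      _ = _ := by rw [h1, h2, h3]; ring
  · intro p hp
    simp only [neg_pow q, neg_one_pow_natAbs_sq]
    have h1 : (-1 : ℂ) ^ p.1.natAbs + (-1) ^ p.2.natAbs = 0 := by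
      rw [even_add_iff_natAbs, Nat.even_add] at hp
      rcases Nat.even_or_odd p.1.natAbs with ha | ha <;>
        rcases Nat.even_or_odd p.2.natAbs with hb | hb
      · exact absurd (by tauto) hp
      · rw [ha.neg_one_pow, hb.neg_one_pow]; norm_num
      · rw [ha.neg_one_pow, hb.neg_one_pow]; norm_num
      · rw [ha.neg_one_pow, hb.neg_one_pow]
        rw [← Nat.not_even_iff_odd] at ha hb
        exact absurd (by tauto) hp
    linear_combination q ^ (p.1.natAbs ^ 2) * q ^ (p.2.natAbs ^ 2) * h1

/-! ### Iteration of q ↦ q² and nonvanishing -/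

lemma tendsto_pow_two_pow {q : ℂ} (hq : ‖q‖ < 1) :
    Filter.Tendsto (fun n : ℕ => q ^ (2 ^ n)) Filter.atTop (nhds 0) :=
  (tendsto_pow_atTop_nhds_zero_of_norm_lt_one hq).comp
    (tendsto_pow_atTop_atTop_of_one_lt one_lt_two)

/-- A property of points of the unit disk which passes from `q` to `q ^ 2` and fails for all small
nonzero `q` fails for all nonzero `q` of the disk. -/
lemma not_of_sq_invariant {p : ℂ → Prop} (hp : ∀ q, ‖q‖ < 1 → p q → p (q ^ 2))
    (h0 : ∀ᶠ q in nhdsWithin 0 {0}ᶜ, ¬ p q) {q : ℂ} (hq : ‖q‖ < 1) (hq0 : q ≠ 0) : ¬ p q := by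
  intro h
  have hn : ∀ n : ℕ, ‖q ^ 2 ^ n‖ < 1 ∧ p (q ^ 2 ^ n) := by
    intro n
    induction n with
    | zero => simpa using ⟨hq, h⟩
    | succ n ih =>
      rw [pow_succ, pow_mul]
      exact ⟨norm_sq_lt_one ih.1, hp _ ih.1 ih.2⟩
  have ht : Filter.Tendsto (fun n : ℕ => q ^ (2 ^ n)) Filter.atTop (nhdsWithin 0 {0}ᶜ) :=
    tendsto_nhdsWithin_iff.mpr ⟨tendsto_pow_two_pow hq, .of_forall fun n => pow_ne_zero _ hq0⟩
  obtain ⟨n, hn'⟩ := (ht.eventually h0).exists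
  exact hn' (hn n).2

/-- A function invariant under `q ↦ q ^ 2` on the punctured unit disk is equal to its limit
at `0`. -/
lemma eq_of_sq_invariant {f : ℂ → ℂ} (hf : ∀ q, ‖q‖ < 1 → q ≠ 0 → f (q ^ 2) = f q) {c : ℂ}
    (h0 : Filter.Tendsto f (nhdsWithin 0 {0}ᶜ) (nhds c)) {q : ℂ} (hq : ‖q‖ < 1) (hq0 : q ≠ 0) :
    f q = c := by
  have hn : ∀ n : ℕ, ‖q ^ 2 ^ n‖ < 1 ∧ f (q ^ 2 ^ n) = f q := by
    intro n
    induction n with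
    | zero => simpa using hq
    | succ n ih =>
      rw [pow_succ, pow_mul]
      exact ⟨norm_sq_lt_one ih.1, (hf _ ih.1 (pow_ne_zero _ hq0)).trans ih.2⟩
  have ht : Filter.Tendsto (fun n : ℕ => q ^ (2 ^ n)) Filter.atTop (nhdsWithin 0 {0}ᶜ) :=
    tendsto_nhdsWithin_iff.mpr ⟨tendsto_pow_two_pow hq, .of_forall fun n => pow_ne_zero _ hq0⟩
  have h := h0.comp ht
  refine tendsto_nhds_unique (tendsto_const_nhds.congr fun n => (hn n).2.symm) h

lemma thetaQ_ne_zero {q : ℂ} (hq : ‖q‖ < 1) : thetaQ q ≠ 0 := by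
  rcases eq_or_ne q 0 with rfl | hq0
  · simp [thetaQ_zero]
  have hc : ∀ᶠ q in nhds (0 : ℂ), thetaQ q ≠ 0 :=
    (analyticAt_thetaQ (by simp)).continuousAt.eventually_ne (by simp [thetaQ_zero])
  have hc' : ∀ᶠ q in nhds (0 : ℂ), thetaQ (-q) ≠ 0 := by
    have := (continuous_neg (G := ℂ)).tendsto 0
    rw [neg_zero] at this
    exact this.eventually hc
  -- By `thetaQ_mul_thetaQ_neg`, a zero of θ₄ at q forces one at q², whereas θ₄ is close to 1 near
  -- 0.
  have key := not_of_sq_invariant (p := fun q => thetaQ (-q) = 0) (fun q hq h => by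
    have := thetaQ_mul_thetaQ_neg hq
    rw [h, mul_zero] at this
    exact pow_eq_zero_iff two_ne_zero |>.mp this.symm) (hc'.filter_mono nhdsWithin_le_nhds)
    (q := -q) (by simpa) (by simpa)
  simpa using key

/-! ### Differential equations in the nome -/

/-- The logarithmic derivative of `thetaQ`. -/
noncomputable def thetaLog (q : ℂ) : ℂ := deriv thetaQ q / thetaQ q

lemma hasDerivAt_thetaQ {q : ℂ} (hq : ‖q‖ < 1) :
    HasDerivAt thetaQ (thetaQ q * thetaLog q) q := by
  rw [thetaLog, mul_div_cancel₀ _ (thetaQ_ne_zero hq)]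
  exact (analyticAt_thetaQ hq).differentiableAt.hasDerivAt

lemma hasDerivAt_thetaQ_neg {q : ℂ} (hq : ‖q‖ < 1) :
    HasDerivAt (fun q => thetaQ (-q)) (-(thetaQ (-q) * thetaLog (-q))) q := by
  have h := (hasDerivAt_thetaQ (q := -q) (by simpa)).comp q (hasDerivAt_neg q)
  simpa [Function.comp_def] using h

lemma analyticAt_thetaLog {q : ℂ} (hq : ‖q‖ < 1) : AnalyticAt ℂ thetaLog q :=
  (analyticAt_thetaQ hq).deriv.div (analyticAt_thetaQ hq) (thetaQ_ne_zero hq)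

lemma thetaLog_zero : thetaLog 0 = 2 := by
  rw [thetaLog, deriv_thetaQ_zero, thetaQ_zero, div_one]

lemma ball_mem_nhds {q : ℂ} (hq : ‖q‖ < 1) : ∀ᶠ w in nhds q, ‖w‖ < 1 :=
  continuous_norm.continuousAt.eventually_lt continuousAt_const hq

lemma thetaLog_neg_sq {q : ℂ} (hq : ‖q‖ < 1) :
    -(4 * q * thetaLog (-q ^ 2)) = thetaLog q - thetaLog (-q) := by
  have hq2 : ‖-q ^ 2‖ < 1 := by simpa using norm_sq_lt_one hq
  have hn : ‖-q‖ < 1 := by simpa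
  have h1 := (hasDerivAt_thetaQ hq).mul (hasDerivAt_thetaQ_neg hq)
  have h2 := ((hasDerivAt_thetaQ hq2).comp q ((hasDerivAt_id q).pow 2).neg).pow 2
  have h3 := (h2.congr_of_eventuallyEq (f₁ := thetaQ * fun q => thetaQ (-q))
    ((ball_mem_nhds hq).mono fun w hw => by
      simpa using thetaQ_mul_thetaQ_neg hw)).unique h1
  simp only [Function.comp_apply, id, Pi.neg_apply, Pi.pow_apply] at h3
  have hne := mul_ne_zero (thetaQ_ne_zero hq) (thetaQ_ne_zero hn)
  have h4 := thetaQ_mul_thetaQ_neg hq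
  apply mul_left_cancel₀ hne
  rw [h4]
  norm_num at h3
  linear_combination h3 + (thetaLog q - thetaLog (-q)) * h4

lemma thetaLog_sq {q : ℂ} (hq : ‖q‖ < 1) :
    2 * q * (thetaQ q ^ 2 + thetaQ (-q) ^ 2) * thetaLog (q ^ 2) =
      thetaQ q ^ 2 * thetaLog q - thetaQ (-q) ^ 2 * thetaLog (-q) := by
  have h1 := ((hasDerivAt_thetaQ hq).pow 2).add ((hasDerivAt_thetaQ_neg hq).pow 2)
  have h2 := (((hasDerivAt_thetaQ (norm_sq_lt_one hq)).comp q
    ((hasDerivAt_id q).pow 2)).pow 2).const_mul 2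
  have h3 := (h1.congr_of_eventuallyEq (f₁ := fun q => 2 * (thetaQ ∘ (id ^ 2)) q ^ 2)
    ((ball_mem_nhds hq).mono fun w hw => by
      simpa using (thetaQ_sq_add_thetaQ_neg_sq hw).symm)).unique h2
  simp only [Function.comp_apply, id, Pi.pow_apply] at h3
  rw [thetaQ_sq_add_thetaQ_neg_sq hq]
  norm_num at h3
  linear_combination -h3 / 2

/-- `θ₃⁴ - θ₄⁴` as a function of the nome. -/
noncomputable def thetaDiff (q : ℂ) : ℂ := thetaQ q ^ 4 - thetaQ (-q) ^ 4

lemma thetaDiff_sq {q : ℂ} (hq : ‖q‖ < 1) :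
    4 * thetaDiff (q ^ 2) = (thetaQ q ^ 2 - thetaQ (-q) ^ 2) ^ 2 := by
  have h1 := thetaQ_sq_add_thetaQ_neg_sq hq
  have h2 := thetaQ_mul_thetaQ_neg hq
  rw [thetaDiff]
  linear_combination -(thetaQ q ^ 2 + thetaQ (-q) ^ 2 + 2 * thetaQ (q ^ 2) ^ 2) * h1 +
    4 * (thetaQ q * thetaQ (-q) + thetaQ (-q ^ 2) ^ 2) * h2

lemma thetaQ_sq_add_ne_zero {q : ℂ} (hq : ‖q‖ < 1) : thetaQ q ^ 2 + thetaQ (-q) ^ 2 ≠ 0 := by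
  rw [thetaQ_sq_add_thetaQ_neg_sq hq]
  exact mul_ne_zero two_ne_zero (pow_ne_zero 2 (thetaQ_ne_zero (norm_sq_lt_one hq)))

lemma thetaDiff_zero : thetaDiff 0 = 0 := by simp [thetaDiff]

lemma hasDerivAt_thetaDiff_zero : HasDerivAt thetaDiff 16 0 := by
  have h := ((hasDerivAt_thetaQ (q := 0) (by simp)).pow 4).sub
    ((hasDerivAt_thetaQ_neg (q := 0) (by simp)).pow 4)
  have h2 : HasDerivAt thetaDiff _ 0 := h
  convert h2 using 1
  simp [thetaQ_zero, thetaLog_zero]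
  norm_num

/-- In the factorisation (θ₃² + θ₄²)(θ₃² - θ₄²) the first factor never vanishes, and the square of
the second is 4 times the value at q². So a zero propagates from q to q², but 0 is an isolated zero.
-/
lemma thetaDiff_ne_zero {q : ℂ} (hq : ‖q‖ < 1) (hq0 : q ≠ 0) : thetaDiff q ≠ 0 := by
  refine not_of_sq_invariant (p := fun q => thetaDiff q = 0) (fun q hq h => ?_) ?_ hq hq0
  · have h1 := thetaDiff_sq hq
    have h2 : (thetaQ q ^ 2 + thetaQ (-q) ^ 2) * (thetaQ q ^ 2 - thetaQ (-q) ^ 2) = 0 := by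
      rw [thetaDiff] at h
      linear_combination h
    rcases mul_eq_zero.mp h2 with h3 | h3
    · exact absurd h3 (thetaQ_sq_add_ne_zero hq)
    · rw [h3] at h1
      linear_combination h1 / 4
  · exact hasDerivAt_thetaDiff_zero.eventually_ne (by norm_num)

lemma tendsto_thetaDiff_div :
    Filter.Tendsto (fun q => thetaDiff q / q) (nhdsWithin 0 {0}ᶜ) (nhds 16) := by
  have := hasDerivAt_iff_tendsto_slope.mp hasDerivAt_thetaDiff_zero
  refine this.congr fun q => ?_
  simp [slope_def_field, thetaDiff_zero]

/-- The differential equation for `θ₃ / θ₄`. -/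
lemma thetaLog_add_thetaLog_neg {q : ℂ} (hq : ‖q‖ < 1) :
    q * (thetaLog q + thetaLog (-q)) = thetaDiff q / 4 := by
  rcases eq_or_ne q 0 with rfl | hq0
  · simp [thetaDiff_zero]
  -- The constant is the ratio at 0: the numerator behaves like 4q, `thetaDiff` like 16q.
  have key := eq_of_sq_invariant
    (f := fun q => q * (thetaLog q + thetaLog (-q)) / thetaDiff q) (c := 1 / 4)
    (fun q hq hq0 => ?_) ?_ hq hq0
  · rw [div_eq_iff (thetaDiff_ne_zero hq hq0)] at key
    rw [key]; ring
  · have h1 := thetaLog_neg_sq hq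
    have h2 := thetaLog_sq hq
    have h3 := thetaDiff_sq hq
    have hs := thetaQ_sq_add_ne_zero hq
    have hd := thetaDiff_ne_zero hq hq0
    have hd2 := thetaDiff_ne_zero (norm_sq_lt_one hq) (pow_ne_zero 2 hq0)
    have hdd : thetaDiff q = (thetaQ q ^ 2 + thetaQ (-q) ^ 2) *
      (thetaQ q ^ 2 - thetaQ (-q) ^ 2) := by rw [thetaDiff]; ring
    have h5 : 4 * q * (thetaQ q ^ 2 + thetaQ (-q) ^ 2) *
        (thetaLog (q ^ 2) + thetaLog (-q ^ 2)) =
        (thetaQ q ^ 2 - thetaQ (-q) ^ 2) * (thetaLog q + thetaLog (-q)) := by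
      linear_combination 2 * h2 - (thetaQ q ^ 2 + thetaQ (-q) ^ 2) * h1
    change q ^ 2 * (thetaLog (q ^ 2) + thetaLog (-q ^ 2)) / thetaDiff (q ^ 2) = _
    rw [div_eq_div_iff hd2 hd]
    linear_combination (q ^ 2 * (thetaLog (q ^ 2) + thetaLog (-q ^ 2))) * hdd +
      q / 4 * (thetaQ q ^ 2 - thetaQ (-q) ^ 2) * h5 -
      q * (thetaLog q + thetaLog (-q)) / 4 * h3
  · have hc : ContinuousAt thetaLog 0 := (analyticAt_thetaLog (by simp)).continuousAt
    have hc' : ContinuousAt (fun q => thetaLog (-q)) 0 := by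
      refine ContinuousAt.comp (g := thetaLog) ?_ continuous_neg.continuousAt
      simpa using hc
    have h1 : Filter.Tendsto (fun q => thetaLog q + thetaLog (-q)) (nhdsWithin 0 {0}ᶜ)
        (nhds (2 + 2)) := by
      have := (hc.add hc').tendsto
      simp only [Pi.add_apply, neg_zero, thetaLog_zero] at this
      exact this.mono_left nhdsWithin_le_nhds
    have h2 := h1.div tendsto_thetaDiff_div (by norm_num)
    rw [show ((2 : ℂ) + 2) / 16 = 1 / 4 by norm_num] at h2
    refine h2.congr' ?_
    filter_upwards [self_mem_nhdsWithin] with q hq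
    simp only [Pi.div_apply]
    rw [div_div_eq_mul_div, mul_comm]

/-- Eliminating `thetaLog (-q)` leaves a transformation law for `thetaLog` alone, which can be
differentiated again. -/
lemma mul_thetaLog_sq {q : ℂ} (hq : ‖q‖ < 1) :
    q ^ 2 * thetaLog (q ^ 2) = q * thetaLog q / 2 -
      thetaQ (-q) ^ 2 * (thetaQ q ^ 2 - thetaQ (-q) ^ 2) / 8 := by
  have h1 := thetaLog_sq hq
  have h2 := thetaLog_add_thetaLog_neg hq
  rw [thetaDiff] at h2
  apply mul_left_cancel₀ (thetaQ_sq_add_ne_zero hq)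
  linear_combination q / 2 * h1 - thetaQ (-q) ^ 2 / 2 * h2

/-- The difference of the two sides of the second order differential equation for `θ₃`. -/
noncomputable def thetaDefect (q : ℂ) : ℂ :=
  q * (thetaLog q + q * deriv thetaLog q) - 2 * (q * thetaLog q) ^ 2 -
    thetaDiff q * thetaQ (-q) ^ 4 / 8

lemma thetaDefect_sq {q : ℂ} (hq : ‖q‖ < 1) :
    thetaDefect (q ^ 2) = thetaDefect q / 4 := by
  have hL {q : ℂ} (hq : ‖q‖ < 1) := (analyticAt_thetaLog hq).differentiableAt.hasDerivAt
  have ha := hasDerivAt_thetaQ hq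
  have hb := hasDerivAt_thetaQ_neg hq
  have e1 := (((hasDerivAt_id q).mul (hL hq)).div_const 2).sub
    (((hb.pow 2).mul ((ha.pow 2).sub (hb.pow 2))).div_const 8)
  have e2 := ((hasDerivAt_id q).pow 2).mul
    ((hL (norm_sq_lt_one hq)).comp q ((hasDerivAt_id q).pow 2))
  have e3 := e2.unique (e1.congr_of_eventuallyEq ((ball_mem_nhds hq).mono fun w hw => by
    simpa using mul_thetaLog_sq hw))
  simp only [Function.comp_apply, id, Pi.pow_apply, Pi.sub_apply] at e3
  norm_num at e3
  have h1 := mul_thetaLog_sq hq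
  have h2 := thetaLog_add_thetaLog_neg hq
  have h3 := thetaDiff_sq hq
  have h4 := thetaQ_mul_thetaQ_neg hq
  have h4' : thetaQ (-q ^ 2) ^ 4 = thetaQ q ^ 2 * thetaQ (-q) ^ 2 := by
    linear_combination -(thetaQ q * thetaQ (-q) + thetaQ (-q ^ 2) ^ 2) * h4
  have hN : q * thetaLog (-q) = thetaDiff q / 4 - q * thetaLog q := by linear_combination h2
  rw [thetaDefect, h4']
  have e4 : q ^ 2 * (thetaLog (q ^ 2) + q ^ 2 * deriv thetaLog (q ^ 2)) =
      q / 2 * (2 * q * thetaLog (q ^ 2) + q ^ 2 * (deriv thetaLog (q ^ 2) * (2 * q))) := by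
    ring
  rw [e4, e3, h1, show thetaDiff (q ^ 2) = (thetaQ q ^ 2 - thetaQ (-q) ^ 2) ^ 2 / 4 by
    linear_combination h3 / 4, thetaDefect]
  have hd : thetaDiff q = thetaQ q ^ 4 - thetaQ (-q) ^ 4 := rfl
  rw [hd] at hN ⊢
  linear_combination (thetaQ (-q) ^ 2 * (thetaQ q ^ 2 - thetaQ (-q) ^ 2) -
    thetaQ (-q) ^ 4) / 8 * hN

lemma differentiableAt_thetaDefect {q : ℂ} (hq : ‖q‖ < 1) :
    DifferentiableAt ℂ thetaDefect q := by
  have h1 := (analyticAt_thetaLog hq).differentiableAt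
  have h2 := (analyticAt_thetaLog hq).deriv.differentiableAt
  have h3 := (hasDerivAt_thetaQ hq).differentiableAt
  have h4 := (hasDerivAt_thetaQ_neg hq).differentiableAt
  unfold thetaDefect thetaDiff
  fun_prop

lemma tendsto_norm_mul_log_sq :
    Filter.Tendsto (fun q : ℂ => ‖q‖ * Real.log ‖q‖ ^ 2) (nhdsWithin 0 {0}ᶜ) (nhds 0) := by
  have h := (tendsto_log_mul_rpow_nhdsGT_zero (r := 1 / 2) (by norm_num)).pow 2
  have h2 := h.comp (tendsto_norm_nhdsNE_zero (E := ℂ))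
  rw [zero_pow two_ne_zero] at h2
  refine h2.congr fun q => ?_
  simp only [Function.comp_apply, mul_pow]
  rw [← Real.rpow_natCast (‖q‖ ^ (1 / 2 : ℝ)), ← Real.rpow_mul (norm_nonneg q)]
  norm_num
  ring

lemma thetaDefect_eq_zero {q : ℂ} (hq : ‖q‖ < 1) : thetaDefect q = 0 := by
  have hz : thetaDefect 0 = 0 := by simp [thetaDefect, thetaDiff_zero]
  rcases eq_or_ne q 0 with rfl | hq0
  · exact hz
  -- Squaring q multiplies log² ‖q‖ by 4, which offsets the factor 1/4 in `thetaDefect_sq`. The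
  -- limit is 0 because the defect is O(q).
  have key := eq_of_sq_invariant
    (f := fun q => thetaDefect q * ((Real.log ‖q‖ ^ 2 : ℝ) : ℂ)) (c := 0)
    (fun q hq _ => ?_) ?_ hq hq0
  · refine (mul_eq_zero.mp key).resolve_right ?_
    have := Real.log_neg (norm_pos_iff.mpr hq0) hq
    exact_mod_cast pow_ne_zero 2 this.ne
  · simp only [thetaDefect_sq hq, norm_pow, Real.log_pow]
    push_cast
    ring
  · have h1 := hasDerivAt_iff_tendsto_slope.mp
      (differentiableAt_thetaDefect (q := 0) (by simp)).hasDerivAt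
    have h2 := h1.norm.mul tendsto_norm_mul_log_sq
    rw [mul_zero] at h2
    rw [tendsto_zero_iff_norm_tendsto_zero]
    refine h2.congr' ?_
    filter_upwards [self_mem_nhdsWithin] with q hq
    have hq' : ‖q‖ ≠ 0 := norm_ne_zero_iff.mpr hq
    simp [slope_def_field, hz]
    field_simp

/-- The second order differential equation for `θ₃`. -/
lemma deriv_thetaLog_eq {q : ℂ} (hq : ‖q‖ < 1) :
    q * (thetaLog q + q * deriv thetaLog q) =
      2 * (q * thetaLog q) ^ 2 + thetaDiff q * thetaQ (-q) ^ 4 / 8 := by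
  have h := thetaDefect_eq_zero hq
  rw [thetaDefect] at h
  linear_combination h

/-! ### Transfer to the unit disk and evenness of σ₃ -/

/-- The nome `q = exp (-π x)` at `x = (1 - z) / (1 + z)`. -/
noncomputable def diskNome (z : ℂ) : ℂ := exp (-(Real.pi : ℂ) * ((1 - z) / (1 + z)))

lemma theta3_eq_thetaQ (x : ℂ) : theta3 x = thetaQ (exp (-(Real.pi : ℂ) * x)) := by
  refine tsum_congr fun n => ?_
  rw [← exp_nat_mul]
  congr 1
  have : ((n.natAbs ^ 2 : ℕ) : ℂ) = (n : ℂ) ^ 2 := by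
    rw [Nat.cast_pow, Nat.cast_natAbs, ← Int.cast_pow, sq_abs, Int.cast_pow]
  rw [this]
  ring

lemma sigma3_eq (z : ℂ) : sigma3 z = 1 / (1 + z) ^ (1 / 2 : ℂ) * thetaQ (diskNome z) := by
  rw [sigma3, theta3_eq_thetaQ, diskNome]

lemma one_add_re_pos {z : ℂ} (hz : ‖z‖ < 1) : 0 < (1 + z).re := by
  have := neg_le_of_abs_le (abs_re_le_norm z)
  simp
  linarith

lemma one_add_ne_zero_of_norm_lt {z : ℂ} (hz : ‖z‖ < 1) : 1 + z ≠ 0 := by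
  intro h
  have := one_add_re_pos hz
  simp [h] at this

lemma cayley_re_pos {z : ℂ} (hz : ‖z‖ < 1) : 0 < ((1 - z) / (1 + z)).re := by
  have h0 : 0 < normSq (1 + z) := normSq_pos.mpr (one_add_ne_zero_of_norm_lt hz)
  have h1 : normSq z < 1 := by
    rw [normSq_eq_norm_sq]
    exact pow_lt_one₀ (norm_nonneg z) hz two_ne_zero
  rw [normSq_apply] at h1
  rw [div_re, ← add_div]
  refine div_pos ?_ h0
  simp
  nlinarith

lemma norm_diskNome_lt {z : ℂ} (hz : ‖z‖ < 1) : ‖diskNome z‖ < 1 := by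
  rw [diskNome, norm_exp, Real.exp_lt_one_iff]
  have h := cayley_re_pos hz
  rw [← ofReal_neg, re_ofReal_mul]
  nlinarith [Real.pi_pos]

lemma diskNome_ne_zero (z : ℂ) : diskNome z ≠ 0 := exp_ne_zero _

lemma theta3_one_div {w : ℂ} (hw : 0 < w.re) : theta3 (1 / w) = w ^ (1 / 2 : ℂ) * theta3 w := by
  have hj (x : ℂ) : theta3 x = jacobiTheta (I * x) := by
    refine tsum_congr fun n => ?_
    congr 1
    linear_combination (-(Real.pi : ℂ) * (n : ℂ) ^ 2 * x) * I_sq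
  have hw0 : w ≠ 0 := by rintro rfl; simp at hw
  have h := jacobiTheta_S_smul ⟨I * w, by simpa using hw⟩
  rw [UpperHalfPlane.modular_S_smul] at h
  simp only at h
  rw [hj, hj]
  convert h using 2
  · field_simp
    rw [I_sq]
  · congr 1
    linear_combination w * I_sq

/-- Changing the sign of z inverts x = (1 - z)/(1 + z), so this is the inversion formula for θ₃. -/
lemma sigma3_neg {z : ℂ} (hz : ‖z‖ < 1) : sigma3 (-z) = sigma3 z := by
  have hz' : ‖-z‖ < 1 := by simpa
  have h1 := one_add_ne_zero_of_norm_lt hz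
  have h2 := one_add_ne_zero_of_norm_lt hz'
  have e : (1 - -z) / (1 + -z) = 1 / ((1 - z) / (1 + z)) := by
    rw [one_div_div, sub_neg_eq_add, ← sub_eq_add_neg]
  rw [← sub_eq_add_neg] at h2
  have a1 := abs_lt.mp (abs_arg_lt_pi_div_two_iff.mpr (.inl (one_add_re_pos hz)))
  have a2 := abs_lt.mp (abs_arg_lt_pi_div_two_iff.mpr (.inl (one_add_re_pos hz')))
  rw [← sub_eq_add_neg] at a2
  -- Both arguments lie in (-π/2, π/2), so their difference stays on the principal branch.
  have hlog : log ((1 - z) / (1 + z)) = log (1 - z) - log (1 + z) := by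
    rw [← log_exp (x := log (1 - z) - log (1 + z)), exp_sub, exp_log h2, exp_log h1]
    · simp only [sub_im, log_im]; linarith
    · simp only [sub_im, log_im]; linarith
  rw [sigma3, sigma3, e, theta3_one_div (cayley_re_pos hz), ← sub_eq_add_neg,
    cpow_def_of_ne_zero (div_ne_zero h2 h1), cpow_def_of_ne_zero h1, cpow_def_of_ne_zero h2,
    hlog, one_div (exp _), ← exp_neg, ← mul_assoc, ← exp_add, one_div (exp _), ← exp_neg]
  congr 2
  ring

lemma hasDerivAt_diskNome {z : ℂ} (hz : ‖z‖ < 1) :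
    HasDerivAt diskNome (diskNome z * (2 * Real.pi / (1 + z) ^ 2)) z := by
  have h1 := one_add_ne_zero_of_norm_lt hz
  have h := ((((hasDerivAt_id z).const_sub 1).div ((hasDerivAt_id z).const_add 1) h1).const_mul
    (-(Real.pi : ℂ))).cexp
  refine h.congr_deriv ?_
  simp only [diskNome, id, Pi.div_apply]
  field_simp
  ring

/-! ### The autonomous differential system on the disk -/

/-- The square of `sigma3`. -/
noncomputable def sigmaSq (z : ℂ) : ℂ := thetaQ (diskNome z) ^ 2 / (1 + z)

/-- The counterpart of `sigmaSq` for `θ₄`. -/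
noncomputable def sigmaFourSq (z : ℂ) : ℂ := thetaQ (-diskNome z) ^ 2 / (1 + z)

/-- The logarithmic derivative of `sigmaSq`. -/
noncomputable def sigmaLog (z : ℂ) : ℂ :=
  4 * Real.pi * (diskNome z * thetaLog (diskNome z)) / (1 + z) ^ 2 - 1 / (1 + z)

lemma sigma3_sq (z : ℂ) : sigma3 z ^ 2 = sigmaSq z := by
  have h : ((1 + z) ^ (1 / 2 : ℂ)) ^ 2 = 1 + z := by
    rw [← cpow_nat_mul]
    norm_num
  rw [sigma3_eq, sigmaSq, mul_pow, div_pow, one_pow, h, one_div_mul_eq_div]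

lemma sigmaSq_ne_zero {z : ℂ} (hz : ‖z‖ < 1) : sigmaSq z ≠ 0 :=
  div_ne_zero (pow_ne_zero 2 (thetaQ_ne_zero (norm_diskNome_lt hz)))
    (one_add_ne_zero_of_norm_lt hz)

lemma sigmaFourSq_ne_zero {z : ℂ} (hz : ‖z‖ < 1) : sigmaFourSq z ≠ 0 :=
  div_ne_zero (pow_ne_zero 2 (thetaQ_ne_zero (by simpa using norm_diskNome_lt hz)))
    (one_add_ne_zero_of_norm_lt hz)

lemma sigmaSq_sq_sub_sigmaFourSq_sq (z : ℂ) :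
    sigmaSq z ^ 2 - sigmaFourSq z ^ 2 = thetaDiff (diskNome z) / (1 + z) ^ 2 := by
  rw [sigmaSq, sigmaFourSq, thetaDiff, div_pow, div_pow, ← sub_div]
  ring

lemma hasDerivAt_sigmaSq {z : ℂ} (hz : ‖z‖ < 1) :
    HasDerivAt sigmaSq (sigmaSq z * sigmaLog z) z := by
  have h1 := one_add_ne_zero_of_norm_lt hz
  have h := (((hasDerivAt_thetaQ (norm_diskNome_lt hz)).comp z (hasDerivAt_diskNome hz)).pow 2).div
    ((hasDerivAt_id z).const_add 1) h1
  refine h.congr_deriv ?_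
  simp only [Function.comp_apply, id, Pi.pow_apply, sigmaSq, sigmaLog]
  field_simp
  ring

lemma hasDerivAt_sigmaFourSq {z : ℂ} (hz : ‖z‖ < 1) :
    HasDerivAt sigmaFourSq
      (sigmaFourSq z * (sigmaLog z - Real.pi * (sigmaSq z ^ 2 - sigmaFourSq z ^ 2))) z := by
  have h1 := one_add_ne_zero_of_norm_lt hz
  have h := (((hasDerivAt_thetaQ_neg (norm_diskNome_lt hz)).comp z (hasDerivAt_diskNome hz)).pow
    2).div ((hasDerivAt_id z).const_add 1) h1
  refine h.congr_deriv ?_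
  have h2 := thetaLog_add_thetaLog_neg (norm_diskNome_lt hz)
  rw [sigmaSq_sq_sub_sigmaFourSq_sq, show thetaDiff (diskNome z) = 4 * (diskNome z *
    (thetaLog (diskNome z) + thetaLog (-diskNome z))) by rw [h2]; ring]
  simp only [Function.comp_apply, id, Pi.pow_apply, sigmaFourSq, sigmaLog]
  field_simp
  ring

/-- This is `deriv_thetaLog_eq` in the variable z; the term -1/(1 + z) in `sigmaLog` absorbs all
explicit dependence on z. -/
lemma hasDerivAt_sigmaLog {z : ℂ} (hz : ‖z‖ < 1) :
    HasDerivAt sigmaLog (sigmaLog z ^ 2 +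
      Real.pi ^ 2 * (sigmaSq z ^ 2 - sigmaFourSq z ^ 2) * sigmaFourSq z ^ 2) z := by
  have h1 := one_add_ne_zero_of_norm_lt hz
  have hq := norm_diskNome_lt hz
  have hL := (analyticAt_thetaLog hq).differentiableAt.hasDerivAt
  have hn := hasDerivAt_diskNome hz
  have hd := (hasDerivAt_id z).const_add 1
  have h := (((hn.mul (hL.comp z hn)).const_mul (4 * Real.pi : ℂ)).div (hd.pow 2)
    (pow_ne_zero 2 h1)).sub ((hasDerivAt_const z (1 : ℂ)).div hd h1)
  refine h.congr_deriv ?_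
  have h2 := deriv_thetaLog_eq hq
  rw [sigmaSq_sq_sub_sigmaFourSq_sq, show thetaDiff (diskNome z) / (1 + z) ^ 2 =
    thetaDiff (diskNome z) * thetaQ (-diskNome z) ^ 4 /
      ((1 + z) ^ 2 * thetaQ (-diskNome z) ^ 4) by
      rw [mul_div_mul_right _ _ (pow_ne_zero 4 (thetaQ_ne_zero (by simpa using hq)))],
    show thetaDiff (diskNome z) * thetaQ (-diskNome z) ^ 4 = 8 * (diskNome z *
      (thetaLog (diskNome z) + diskNome z * deriv thetaLog (diskNome z)) -
      2 * (diskNome z * thetaLog (diskNome z)) ^ 2) by rw [h2]; ring]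
  have h3 : thetaQ (-diskNome z) ≠ 0 := thetaQ_ne_zero (by simpa using hq)
  simp only [Function.comp_apply, id, Pi.pow_apply, Pi.mul_apply, sigmaFourSq, sigmaLog]
  field_simp
  ring

lemma differentiableOn_sigma3 : DifferentiableOn ℂ sigma3 (Metric.ball 0 1) := by
  intro z hz
  rw [mem_ball_zero_iff] at hz
  have h1 : DifferentiableAt ℂ (fun z => thetaQ (diskNome z)) z :=
    (hasDerivAt_thetaQ (norm_diskNome_lt hz)).differentiableAt.comp z
      (hasDerivAt_diskNome hz).differentiableAt
  have h2 : DifferentiableAt ℂ (fun z : ℂ => (1 + z) ^ (1 / 2 : ℂ)) z :=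
    (((hasDerivAt_id z).const_add 1).cpow_const (.inl (one_add_re_pos hz))).differentiableAt
  have h3 : (1 + z) ^ (1 / 2 : ℂ) ≠ 0 := by
    simp [cpow_eq_zero_iff, one_add_ne_zero_of_norm_lt hz]
  have h4 : DifferentiableAt ℂ (fun z => 1 / (1 + z) ^ (1 / 2 : ℂ) * thetaQ (diskNome z)) z :=
    ((differentiableAt_const 1).div h2 h3).mul h1
  rw [show sigma3 = fun z => 1 / (1 + z) ^ (1 / 2 : ℂ) * thetaQ (diskNome z) from
    funext sigma3_eq]
  exact h4.differentiableWithinAt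

lemma iteratedDeriv_odd_eq_zero {f : ℂ → ℂ} (hf : ∀ᶠ z in nhds 0, f (-z) = f z) {n : ℕ}
    (hn : Odd n) : iteratedDeriv n f 0 = 0 := by
  have h1 := iteratedDeriv_comp_neg n f 0
  have h2 : iteratedDeriv n (fun z => f (-z)) 0 = iteratedDeriv n f 0 :=
    Filter.EventuallyEq.iteratedDeriv_eq n hf
  rw [h2, hn.neg_one_pow, neg_zero] at h1
  have h3 : iteratedDeriv n f 0 = -iteratedDeriv n f 0 := by simpa using h1
  linear_combination h3 / 2

lemma ball_mem_nhds_zero : ∀ᶠ w : ℂ in nhds 0, ‖w‖ < 1 := ball_mem_nhds (by simp)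

lemma sigmaLog_zero : sigmaLog 0 = 0 := by
  have h : deriv sigmaSq 0 = 0 := by
    rw [← iteratedDeriv_one]
    refine iteratedDeriv_odd_eq_zero ?_ odd_one
    filter_upwards [ball_mem_nhds_zero] with z hz
    rw [← sigma3_sq, ← sigma3_sq, sigma3_neg hz]
  rw [(hasDerivAt_sigmaSq (by simp)).deriv] at h
  exact (mul_eq_zero.mp h).resolve_left (sigmaSq_ne_zero (by simp))

lemma sigmaLog_neg {z : ℂ} (hz : ‖z‖ < 1) : sigmaLog (-z) = -sigmaLog z := by
  have hz' : ‖-z‖ < 1 := by simpa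
  have he : ∀ z : ℂ, ‖z‖ < 1 → sigmaSq (-z) = sigmaSq z := fun z hz => by
    rw [← sigma3_sq, ← sigma3_sq, sigma3_neg hz]
  have h1 := (hasDerivAt_sigmaSq hz').comp z (hasDerivAt_neg z)
  have h2 := h1.unique ((hasDerivAt_sigmaSq hz).congr_of_eventuallyEq
    ((ball_mem_nhds hz).mono fun w hw => he w hw))
  rw [he z hz] at h2
  apply mul_left_cancel₀ (sigmaSq_ne_zero hz)
  linear_combination -h2

/-- At the fixed point `i` we have `θ₃⁴ = 2 θ₄⁴`. -/
lemma sigmaSq_zero_sq : sigmaSq 0 ^ 2 = 2 * sigmaFourSq 0 ^ 2 := by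
  have h0 : ‖(0 : ℂ)‖ < 1 := by simp
  have hd := ((hasDerivAt_sigmaSq h0).pow 2).sub ((hasDerivAt_sigmaFourSq h0).pow 2)
  have h1 := (hd.const_mul (Real.pi ^ 2 : ℂ)).mul ((hasDerivAt_sigmaFourSq h0).pow 2)
  have h2 := ((hasDerivAt_sigmaLog h0).pow 2).add h1
  have hev : ∀ᶠ z in nhds (0 : ℂ), deriv sigmaLog (-z) = deriv sigmaLog z := by
    filter_upwards [ball_mem_nhds_zero] with z hz
    have hz' : ‖-z‖ < 1 := by simpa
    have e1 := (hasDerivAt_sigmaLog hz').comp z (hasDerivAt_neg z)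
    have e2 := e1.unique ((hasDerivAt_sigmaLog hz).neg.congr_of_eventuallyEq
      ((ball_mem_nhds hz).mono fun w hw => sigmaLog_neg hw))
    rw [(hasDerivAt_sigmaLog hz).deriv, (hasDerivAt_sigmaLog hz').deriv]
    linear_combination -e2
  -- `sigmaLog` is odd, so its second derivative vanishes at 0. By the system this derivative is
  -- 2π³F²(S² - F²)(2F² - S²), with S and F the values of `sigmaSq` and `sigmaFourSq`; only the last
  -- factor can be zero.
  have h3 := iteratedDeriv_odd_eq_zero hev odd_one
  rw [iteratedDeriv_one] at h3
  have h4 := h2.congr_of_eventuallyEq (f₁ := deriv sigmaLog)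
    (ball_mem_nhds_zero.mono fun w hw => (hasDerivAt_sigmaLog hw).deriv)
  rw [h4.deriv, sigmaLog_zero] at h3
  simp only [Pi.pow_apply, Pi.sub_apply] at h3
  norm_num at h3
  have hB := sigmaFourSq_ne_zero h0
  have hD : sigmaSq 0 ^ 2 - sigmaFourSq 0 ^ 2 ≠ 0 := by
    rw [sigmaSq_sq_sub_sigmaFourSq_sq]
    exact div_ne_zero (thetaDiff_ne_zero (norm_diskNome_lt h0) (diskNome_ne_zero 0)) (by simp)
  have hpi : (Real.pi : ℂ) ≠ 0 := by exact_mod_cast Real.pi_ne_zero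
  have h5 : (2 * (Real.pi : ℂ) ^ 3 * sigmaFourSq 0 ^ 2 * (sigmaSq 0 ^ 2 - sigmaFourSq 0 ^ 2)) *
      (sigmaSq 0 ^ 2 - 2 * sigmaFourSq 0 ^ 2) = 0 := by
    linear_combination -h3
  have h6 := (mul_eq_zero.mp h5).resolve_left
    (mul_ne_zero (mul_ne_zero (mul_ne_zero two_ne_zero (pow_ne_zero 3 hpi)) (pow_ne_zero 2 hB)) hD)
  linear_combination h6

/-! ### Integrality of the Taylor coefficients -/

/-- If three functions satisfy a first order differential system whose right-hand sides are `k`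
times integral polynomials in them, and have integral values at `0`, then the derivatives of order
`n` of the first one at `0` are in `k ^ n ℤ`. -/
lemma iteratedDeriv_mem_of_polynomial_system {f : Fin 3 → ℂ → ℂ} {k : ℂ}
    (R : Fin 3 → MvPolynomial (Fin 3) ℤ) {U : Set ℂ} (hU : IsOpen U) (h0 : (0 : ℂ) ∈ U)
    (hf : ∀ i, ∀ z ∈ U, HasDerivAt (f i) (k * MvPolynomial.aeval (fun j => f j z) (R i)) z)
    (hv : ∀ i, ∃ m : ℤ, f i 0 = m) (n : ℕ) :
    ∃ m : ℤ, iteratedDeriv n (f 0) 0 = k ^ n * m := by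
  -- Differentiation along the system is k times a derivation of the integral polynomial ring.
  have hD : ∀ p : MvPolynomial (Fin 3) ℤ, ∃ p' : MvPolynomial (Fin 3) ℤ, ∀ z ∈ U,
      HasDerivAt (fun z => MvPolynomial.aeval (fun j => f j z) p)
        (k * MvPolynomial.aeval (fun j => f j z) p') z := by
    intro p
    induction p using MvPolynomial.induction_on with
    | C a =>
      refine ⟨0, fun z hz => ?_⟩
      simpa using hasDerivAt_const z (a : ℂ)
    | add p q hp hq =>
      obtain ⟨p', hp⟩ := hp
      obtain ⟨q', hq⟩ := hq
      refine ⟨p' + q', fun z hz => ?_⟩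
      simp only [map_add, mul_add]
      exact (hp z hz).add (hq z hz)
    | mul_X p i hp =>
      obtain ⟨p', hp⟩ := hp
      refine ⟨p' * MvPolynomial.X i + p * R i, fun z hz => ?_⟩
      simp only [map_mul, map_add, MvPolynomial.aeval_X]
      refine ((hp z hz).mul (hf i z hz)).congr_deriv ?_
      ring
  have hn : ∀ n, ∃ p : MvPolynomial (Fin 3) ℤ, ∀ z ∈ U, iteratedDeriv n (f 0) z =
      k ^ n * MvPolynomial.aeval (fun j => f j z) p := by
    intro n
    induction n with
    | zero => exact ⟨MvPolynomial.X 0, fun z _ => by simp⟩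
    | succ n ih =>
      obtain ⟨p, hp⟩ := ih
      obtain ⟨p', hp'⟩ := hD p
      refine ⟨p', fun z hz => ?_⟩
      rw [iteratedDeriv_succ, (((hp' z hz).const_mul (k ^ n)).congr_of_eventuallyEq
        (Filter.mem_of_superset (hU.mem_nhds hz) fun w hw => hp w hw)).deriv]
      ring
  obtain ⟨p, hp⟩ := hn n
  choose v hv using hv
  refine ⟨MvPolynomial.aeval v p, ?_⟩
  rw [hp 0 h0]
  congr 1
  rw [show (fun j => f j 0) = algebraMap ℤ ℂ ∘ v from funext fun j => by simp [hv j],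
    MvPolynomial.aeval_algebraMap_apply]
  simp

lemma sum_range_two_mul_add_one {f : ℕ → ℂ} (hf : ∀ i, Odd i → f i = 0) (n : ℕ) :
    ∑ i ∈ Finset.range (2 * n + 1), f i = ∑ j ∈ Finset.range (n + 1), f (2 * j) := by
  induction n with
  | zero => simp
  | succ n ih =>
    rw [show 2 * (n + 1) + 1 = 2 * n + 1 + 1 + 1 by ring, Finset.sum_range_succ,
      Finset.sum_range_succ, ih, Finset.sum_range_succ _ (n + 1), hf (2 * n + 1) ⟨n, rfl⟩,
      add_zero]
    rfl

/-- The terms j and n - j are equal and cancel modulo 2; a fixed point j = n - j carries a central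
binomial coefficient, which is even. -/
lemma two_dvd_sum_choose_mul (f : ℕ → ℤ) (n : ℕ) :
    (2 : ℤ) ∣ ∑ j ∈ Finset.Ico 1 n, ((2 * n).choose (2 * j) : ℤ) * f j * f (n - j) := by
  rw [← Nat.cast_ofNat (R := ℤ), ← ZMod.intCast_zmod_eq_zero_iff_dvd, Int.cast_sum]
  refine Finset.sum_involution (fun j _ => n - j) (fun j hj => ?_) (fun j hj h => ?_)
    (fun j hj => ?_) (fun j hj => ?_)
  · rw [Finset.mem_Ico] at hj
    have h1 : (2 * n).choose (2 * (n - j)) = (2 * n).choose (2 * j) := by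
      rw [Nat.mul_sub, Nat.choose_symm (by omega)]
    rw [h1, show n - (n - j) = j by omega, mul_right_comm, CharTwo.add_self_eq_zero]
  · rw [Finset.mem_Ico] at hj
    intro h2
    apply h
    have h3 : 2 * n = 2 * (2 * j) := by omega
    have h4 : ((2 * n).choose (2 * j) : ZMod 2) = 0 := by
      rw [h3, ← Nat.centralBinom_eq_two_mul_choose, ZMod.natCast_eq_zero_iff]
      exact Nat.two_dvd_centralBinom_of_one_le (by omega)
    push_cast
    rw [h4]
    ring
  · rw [Finset.mem_Ico] at hj ⊢
    omega
  · rw [Finset.mem_Ico] at hj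
    omega

/-- Integrality of a rescaled square root of an even Hurwitz series. -/
lemma exists_int_of_sum_choose_mul {d : ℕ → ℂ} (h0 : d 0 = 1)
    (h : ∀ n, ∃ m : ℤ, ∑ j ∈ Finset.range (n + 1), ((2 * n).choose (2 * j) : ℂ) * d j * d (n - j) =
      2 ^ n * m) (n : ℕ) : ∃ m : ℤ, d n = m := by
  induction n using Nat.strong_induction_on with
  | _ n ih =>
    rcases Nat.eq_zero_or_pos n with rfl | hn
    · exact ⟨1, by simpa using h0⟩
    choose! f hf using ih
    obtain ⟨m, hm⟩ := h n
    obtain ⟨s, hs⟩ := two_dvd_sum_choose_mul f n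
    rw [Finset.sum_range_succ, Finset.range_eq_Ico, Finset.sum_eq_sum_Ico_succ_bot hn,
      Finset.sum_congr rfl (g := fun j => ((((2 * n).choose (2 * j) : ℤ) * f j * f (n - j) : ℤ) : ℂ))
      (fun j hj => by
        rw [Finset.mem_Ico] at hj
        rw [hf j (by omega), hf (n - j) (by omega)]
        push_cast
        ring), ← Int.cast_sum, hs] at hm
    simp only [mul_zero, Nat.choose_zero_right, Nat.choose_self, Nat.sub_self, Nat.sub_zero,
      h0, Nat.cast_one, one_mul, mul_one] at hm
    obtain ⟨r, rfl⟩ : ∃ r, n = r + 1 := ⟨n - 1, by omega⟩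
    -- The two end terms of the convolution give 2d(n) = 2ⁿm - 2s.
    refine ⟨2 ^ r * m - s, ?_⟩
    push_cast at hm ⊢
    rw [pow_succ] at hm
    linear_combination hm / 2

lemma sigmaSq_zero_ne_zero : sigmaSq 0 ≠ 0 := sigmaSq_ne_zero (by simp)

lemma iteratedDeriv_sigmaSq (n : ℕ) : ∃ m : ℤ,
    iteratedDeriv n sigmaSq 0 = sigmaSq 0 * (Real.pi * sigmaSq 0 ^ 2 / 2) ^ n * m := by
  set A := sigmaSq 0 with hA
  have hA0 : A ≠ 0 := sigmaSq_zero_ne_zero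
  have hpi : (Real.pi : ℂ) ≠ 0 := by exact_mod_cast Real.pi_ne_zero
  set k : ℂ := Real.pi * A ^ 2 / 2 with hk
  have hB : sigmaFourSq 0 ^ 2 = A ^ 2 / 2 := by rw [hA, sigmaSq_zero_sq]; ring
  let X : Fin 3 → MvPolynomial (Fin 3) ℤ := MvPolynomial.X
  -- The factor 2 in the second function makes its initial value 1, since θ₃⁴ = 2θ₄⁴ at 0; with this
  -- k all coefficients of the system become integers.
  obtain ⟨m, hm⟩ := iteratedDeriv_mem_of_polynomial_system (k := k)
    (f := ![fun z => sigmaSq z / A, fun z => 2 * sigmaFourSq z ^ 2 / A ^ 2,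
      fun z => sigmaLog z / k])
    ![X 0 * X 2, 2 * X 1 * (X 2 - 2 * X 0 ^ 2 + X 1), X 2 ^ 2 + (2 * X 0 ^ 2 - X 1) * X 1]
    (Metric.isOpen_ball (x := 0) (ε := 1)) (by simp) (by
      intro i z hz
      rw [mem_ball_zero_iff] at hz
      fin_cases i
      · refine ((hasDerivAt_sigmaSq hz).div_const A).congr_deriv ?_
        simp [X]
        rw [hk]
        field_simp
      · refine ((((hasDerivAt_sigmaFourSq hz).pow 2).const_mul 2).div_const (A ^ 2)).congr_deriv ?_
        simp [X]
        rw [hk]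
        field_simp
        ring
      · refine ((hasDerivAt_sigmaLog hz).div_const k).congr_deriv ?_
        simp [X]
        rw [hk]
        field_simp) (by
      intro i
      fin_cases i
      · exact ⟨1, by simp [← hA, hA0]⟩
      · exact ⟨1, by simp [hB]; field_simp⟩
      · exact ⟨0, by simp [sigmaLog_zero]⟩) n
  refine ⟨m, ?_⟩
  simp only [Matrix.cons_val_zero, iteratedDeriv_div_const] at hm
  rw [div_eq_iff hA0] at hm
  rw [hm]
  ring

lemma sigma3_zero : sigma3 0 = theta3 1 := by simp [sigma3]

lemma sigmaSq_zero : sigmaSq 0 = theta3 1 ^ 2 := by rw [← sigma3_sq, sigma3_zero]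

lemma theta3_one_ne_zero : theta3 1 ≠ 0 := by
  have := sigmaSq_zero_ne_zero
  rw [sigmaSq_zero] at this
  exact fun h => this (by simp [h])

lemma iteratedDeriv_sigma3_odd {n : ℕ} (hn : Odd n) : iteratedDeriv n sigma3 0 = 0 :=
  iteratedDeriv_odd_eq_zero (ball_mem_nhds_zero.mono fun _ hw => sigma3_neg hw) hn

lemma hasSum_sigma3 {z : ℂ} (hz : ‖z‖ < 1) :
    HasSum (fun n : ℕ => iteratedDeriv (2 * n) sigma3 0 / ((2 * n).factorial : ℂ) * z ^ (2 * n))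
      (sigma3 z) := by
  have h := hasSum_taylorSeries_on_ball (c := 0) (r := 1) (z := z) (f := sigma3)
    (by simpa using differentiableOn_sigma3) (by simpa using hz)
  rw [← (mul_right_injective₀ two_ne_zero : Function.Injective (fun n : ℕ => 2 * n)).hasSum_iff]
    at h
  · refine h.congr_fun fun n => ?_
    simp
    ring
  · intro n hn
    have : Odd n := by
      rw [← Nat.not_even_iff_odd]
      rintro ⟨k, rfl⟩
      exact hn ⟨k, by simp; ring⟩
    simp [iteratedDeriv_sigma3_odd this]

lemma dCoeff_integral (hPhi : (PhiConst : ℂ) = Real.pi ^ 2 * theta3 1 ^ 8 / 8) (n : ℕ) :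
    ∃ m : ℤ, dCoeff n = m := by
  have ht := theta3_one_ne_zero
  have hpi : (Real.pi : ℂ) ≠ 0 := by exact_mod_cast Real.pi_ne_zero
  refine exists_int_of_sum_choose_mul (d := dCoeff) ?_ (fun n => ?_) n
  · simp [dCoeff, sigma3_zero, ht]
  obtain ⟨m, hm⟩ := iteratedDeriv_sigmaSq (2 * n)
  refine ⟨m, ?_⟩
  have hs : sigmaSq = sigma3 * sigma3 := by
    funext z
    rw [← sigma3_sq, Pi.mul_apply, sq]
  have hc : ContDiffAt ℂ (2 * n : ℕ) sigma3 0 :=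
    (differentiableOn_sigma3.analyticAt (Metric.isOpen_ball.mem_nhds (by simp))).contDiffAt
  rw [sigmaSq_zero, hs, iteratedDeriv_mul hc hc, sum_range_two_mul_add_one (fun i hi => by
    rw [iteratedDeriv_sigma3_odd hi]; ring)] at hm
  have hP : (PhiConst : ℂ) ≠ 0 := by
    rw [hPhi]
    exact div_ne_zero (mul_ne_zero (pow_ne_zero 2 hpi) (pow_ne_zero 8 ht)) (by norm_num)
  have hterm : ∀ j ∈ Finset.range (n + 1), ((2 * n).choose (2 * j) : ℂ) * dCoeff j * dCoeff (n - j) =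
      (2 * n).choose (2 * j) * iteratedDeriv (2 * j) sigma3 0 *
        iteratedDeriv (2 * n - 2 * j) sigma3 0 / (theta3 1 ^ 2 * (PhiConst : ℂ) ^ n) := by
    intro j hj
    have hj' : j ≤ n := Nat.lt_succ_iff.mp (Finset.mem_range.mp hj)
    rw [dCoeff, dCoeff, Nat.mul_sub, show (PhiConst : ℂ) ^ n = PhiConst ^ j * PhiConst ^ (n - j) by
      rw [← pow_add, Nat.add_sub_cancel' hj']]
    field_simp
  rw [Finset.sum_congr rfl hterm, ← Finset.sum_div, hm, pow_mul]
  rw [div_eq_iff (mul_ne_zero (pow_ne_zero 2 ht) (pow_ne_zero n hP)), hPhi]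
  -- This is k² = 2Φ, the source of the factor 2ⁿ.
  have : ((Real.pi : ℂ) * (theta3 1 ^ 2) ^ 2 / 2) ^ 2 = 2 * (Real.pi ^ 2 * theta3 1 ^ 8 / 8) := by
    ring
  rw [this, mul_pow 2]
  ring

/-! ### The arithmetic-geometric mean of θ₃² and θ₄² -/

/-- The complete elliptic integral `∫_ℝ dt / √((t² + a²) (t² + b²))`. -/
noncomputable def agmIntegral (a b : ℝ) : ℝ := ∫ t : ℝ, (√((t ^ 2 + a ^ 2) * (t ^ 2 + b ^ 2)))⁻¹

lemma agmIntegral_eq_two_mul (a b : ℝ) : agmIntegral a b =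
    2 * ∫ t in Set.Ioi (0 : ℝ), (√((t ^ 2 + a ^ 2) * (t ^ 2 + b ^ 2)))⁻¹ := by
  rw [← integral_comp_abs (f := fun t : ℝ => (√((t ^ 2 + a ^ 2) * (t ^ 2 + b ^ 2)))⁻¹)]
  simp [agmIntegral]

/-- Gauss' transformation: the integral is invariant under one step of the arithmetic-geometric
mean. -/
lemma agmIntegral_agm {a b b' : ℝ} (ha : 0 < a) (hb : 0 < b) (hb' : b' ^ 2 = a * b) :
    agmIntegral ((a + b) / 2) b' = agmIntegral a b := by
  have hab := mul_pos ha hb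
  -- Gauss' substitution u = (t - ab/t)/2 maps the half-line bijectively onto ℝ; t = u + √(u² + ab)
  -- is the positive root.
  have himg : (fun t : ℝ => (t - a * b / t) / 2) '' Set.Ioi 0 = Set.univ := by
    rw [Set.eq_univ_iff_forall]
    intro u
    have h1 : 0 ≤ u ^ 2 + a * b := by positivity
    have h2 := Real.sq_sqrt h1
    have h3 : 0 < u + √(u ^ 2 + a * b) := by
      have : |u| < √(u ^ 2 + a * b) := by
        rw [← Real.sqrt_sq_eq_abs]
        exact Real.sqrt_lt_sqrt (sq_nonneg u) (by linarith)
      linarith [neg_abs_le u]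
    refine ⟨u + √(u ^ 2 + a * b), h3, ?_⟩
    simp only
    field_simp
    linear_combination h2
  have hinj : Set.InjOn (fun t : ℝ => (t - a * b / t) / 2) (Set.Ioi 0) := by
    intro s hs t ht h
    rw [Set.mem_Ioi] at hs ht
    simp only at h
    field_simp at h
    have h1 : (s - t) * (s * t + a * b) = 0 := by linear_combination h
    have h2 : 0 < s * t + a * b := by positivity
    linarith [(mul_eq_zero.mp h1).resolve_right h2.ne']
  have hder : ∀ t ∈ Set.Ioi (0 : ℝ), HasDerivWithinAt (fun t : ℝ => (t - a * b / t) / 2)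
      ((1 + a * b / t ^ 2) / 2) (Set.Ioi 0) t := by
    intro t ht
    have ht0 : t ≠ 0 := (Set.mem_Ioi.mp ht).ne'
    have h := (((hasDerivAt_id t).sub ((hasDerivAt_const t (a * b)).div (hasDerivAt_id t)
      ht0)).div_const 2)
    refine (h.congr_deriv ?_).hasDerivWithinAt
    simp
    ring
  rw [agmIntegral, ← MeasureTheory.setIntegral_univ, ← himg,
    MeasureTheory.integral_image_eq_integral_abs_deriv_smul measurableSet_Ioi hder hinj,
    agmIntegral_eq_two_mul a b, ← MeasureTheory.integral_const_mul]
  refine MeasureTheory.setIntegral_congr_fun measurableSet_Ioi fun t ht => ?_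
  rw [Set.mem_Ioi] at ht
  have h1 : (((t - a * b / t) / 2) ^ 2 + ((a + b) / 2) ^ 2) * (((t - a * b / t) / 2) ^ 2 + b' ^ 2) =
      (t ^ 2 + a ^ 2) * (t ^ 2 + b ^ 2) * ((t ^ 2 + a * b) / (4 * t ^ 2)) ^ 2 := by
    rw [hb']
    field_simp
    ring
  have h2 : 0 ≤ (t ^ 2 + a * b) / (4 * t ^ 2) := by positivity
  have h3 : 0 < √((t ^ 2 + a ^ 2) * (t ^ 2 + b ^ 2)) := Real.sqrt_pos.mpr (by positivity)
  simp only [smul_eq_mul]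
  rw [h1, Real.sqrt_mul (by positivity), Real.sqrt_sq h2, abs_of_nonneg (by positivity)]
  field_simp
  norm_num

lemma integrable_inv_sq_add_sq {c : ℝ} (hc : 0 < c) :
    MeasureTheory.Integrable (fun t : ℝ => (t ^ 2 + c ^ 2)⁻¹) := by
  have h := (integrable_inv_one_add_sq.comp_div hc.ne').const_mul (c ^ 2)⁻¹
  refine h.congr (.of_forall fun t => ?_)
  simp only
  rw [← mul_inv]
  congr 1
  field_simp
  ring

lemma integral_real_inv_sq_add_sq {c : ℝ} (hc : 0 < c) :
    ∫ t : ℝ, (t ^ 2 + c ^ 2)⁻¹ = Real.pi / c := by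
  have h := MeasureTheory.Measure.integral_comp_div (fun t : ℝ => (1 + t ^ 2)⁻¹) c
  rw [integral_univ_inv_one_add_sq, abs_of_pos hc, smul_eq_mul] at h
  have h2 : ∀ t : ℝ, (t ^ 2 + c ^ 2)⁻¹ = (c ^ 2)⁻¹ * (1 + (t / c) ^ 2)⁻¹ := fun t => by
    rw [← mul_inv]
    congr 1
    field_simp
    ring
  simp_rw [h2]
  rw [MeasureTheory.integral_const_mul, h]
  field_simp

lemma agmIntegrand_le {l a b t : ℝ} (hl : 0 < l) (ha : l ≤ a) (hb : l ≤ b) :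
    (√((t ^ 2 + a ^ 2) * (t ^ 2 + b ^ 2)))⁻¹ ≤ (t ^ 2 + l ^ 2)⁻¹ := by
  refine inv_anti₀ (by positivity) (Real.le_sqrt_of_sq_le ?_)
  rw [sq]
  gcongr

lemma le_agmIntegrand {u a b t : ℝ} (ha0 : 0 < a) (hb0 : 0 < b) (ha : a ≤ u) (hb : b ≤ u) :
    (t ^ 2 + u ^ 2)⁻¹ ≤ (√((t ^ 2 + a ^ 2) * (t ^ 2 + b ^ 2)))⁻¹ := by
  refine inv_anti₀ (Real.sqrt_pos.mpr (by positivity)) (Real.sqrt_le_iff.mpr ⟨by positivity, ?_⟩)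
  rw [sq (t ^ 2 + u ^ 2)]
  gcongr

lemma integrable_agmIntegrand {a b : ℝ} (ha : 0 < a) (hb : 0 < b) :
    MeasureTheory.Integrable (fun t : ℝ => (√((t ^ 2 + a ^ 2) * (t ^ 2 + b ^ 2)))⁻¹) := by
  have hl : 0 < min a b := lt_min ha hb
  refine (integrable_inv_sq_add_sq hl).mono' ?_ (.of_forall fun t => ?_)
  · exact Measurable.aestronglyMeasurable (by fun_prop)
  · rw [Real.norm_of_nonneg (by positivity)]
    exact agmIntegrand_le hl (min_le_left _ _) (min_le_right _ _)

lemma agmIntegral_le {a b : ℝ} (ha : 0 < a) (hb : 0 < b) :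
    agmIntegral a b ≤ Real.pi / min a b := by
  have hl : 0 < min a b := lt_min ha hb
  rw [← integral_real_inv_sq_add_sq hl]
  exact MeasureTheory.integral_mono (integrable_agmIntegrand ha hb) (integrable_inv_sq_add_sq hl)
    fun t => agmIntegrand_le hl (min_le_left _ _) (min_le_right _ _)

lemma le_agmIntegral {a b : ℝ} (ha : 0 < a) (hb : 0 < b) :
    Real.pi / max a b ≤ agmIntegral a b := by
  have hu : 0 < max a b := lt_max_of_lt_left ha
  rw [← integral_real_inv_sq_add_sq hu]
  exact MeasureTheory.integral_mono (integrable_inv_sq_add_sq hu) (integrable_agmIntegrand ha hb)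
    fun t => le_agmIntegrand ha hb (le_max_left _ _) (le_max_right _ _)

/-- `thetaQ` on the real line. -/
noncomputable def thetaR (q : ℝ) : ℝ := ∑' n : ℤ, q ^ (n.natAbs ^ 2)

lemma thetaQ_ofReal (q : ℝ) : thetaQ q = thetaR q := by
  rw [thetaQ, thetaR, ofReal_tsum]
  push_cast
  rfl

lemma thetaR_ne_zero {q : ℝ} (hq : |q| < 1) : thetaR q ≠ 0 := by
  have h := thetaQ_ne_zero (q := q) (by simpa using hq)
  rw [thetaQ_ofReal] at h
  exact_mod_cast h

lemma continuousAt_thetaR_zero : ContinuousAt thetaR 0 := by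
  have h1 : ContinuousAt thetaQ ((0 : ℝ) : ℂ) := (analyticAt_thetaQ (by simp)).continuousAt
  have h2 := (continuous_re.continuousAt).comp (h1.comp continuous_ofReal.continuousAt)
  refine h2.congr (.of_forall fun q => ?_)
  simp [thetaQ_ofReal]

lemma thetaR_zero : thetaR 0 = 1 := by
  have h := thetaQ_ofReal 0
  rw [ofReal_zero, thetaQ_zero] at h
  exact_mod_cast h.symm

/-- By the quadratic relations, q ↦ q² replaces (θ₃², θ₄²) by their arithmetic and geometric means.
-/
lemma agmIntegral_thetaR_sq {q : ℝ} (hq : |q| < 1) :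
    agmIntegral (thetaR (q ^ 2) ^ 2) (thetaR (-q ^ 2) ^ 2) =
      agmIntegral (thetaR q ^ 2) (thetaR (-q) ^ 2) := by
  have hq' : ‖(q : ℂ)‖ < 1 := by simpa using hq
  have h1 := thetaQ_sq_add_thetaQ_neg_sq hq'
  have h2 := thetaQ_mul_thetaQ_neg hq'
  rw [← ofReal_pow, ← ofReal_neg, thetaQ_ofReal, thetaQ_ofReal, thetaQ_ofReal] at h1
  rw [← ofReal_pow, ← ofReal_neg, ← ofReal_neg, thetaQ_ofReal, thetaQ_ofReal, thetaQ_ofReal] at h2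
  norm_cast at h1 h2
  have h3 := thetaR_ne_zero hq
  have h4 := thetaR_ne_zero (q := -q) (by simpa using hq)
  rw [← agmIntegral_agm (a := thetaR q ^ 2) (b := thetaR (-q) ^ 2) (b' := thetaR (-q ^ 2) ^ 2) (by positivity) (by positivity)]
  · congr 1
    linear_combination -h1 / 2
  · rw [← h2]
    ring

/-- The arithmetic-geometric mean of `θ₃²` and `θ₄²` is `1`. -/
lemma agmIntegral_thetaR {q : ℝ} (hq : |q| < 1) :
    agmIntegral (thetaR q ^ 2) (thetaR (-q) ^ 2) = Real.pi := by
  have hn : ∀ n : ℕ, |q ^ 2 ^ n| < 1 ∧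
      agmIntegral (thetaR (q ^ 2 ^ n) ^ 2) (thetaR (-q ^ 2 ^ n) ^ 2) =
      agmIntegral (thetaR q ^ 2) (thetaR (-q) ^ 2) := by
    intro n
    induction n with
    | zero => simpa using hq
    | succ n ih =>
      rw [pow_succ, pow_mul]
      refine ⟨?_, (agmIntegral_thetaR_sq ih.1).trans ih.2⟩
      rw [abs_pow]
      exact pow_lt_one₀ (abs_nonneg _) ih.1 two_ne_zero
  have ht : Filter.Tendsto (fun n : ℕ => q ^ (2 ^ n)) Filter.atTop (nhds 0) :=
    (tendsto_pow_atTop_nhds_zero_of_abs_lt_one hq).comp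
      (tendsto_pow_atTop_atTop_of_one_lt one_lt_two)
  have hc := continuousAt_thetaR_zero.tendsto
  rw [thetaR_zero] at hc
  have ha : Filter.Tendsto (fun n : ℕ => thetaR (q ^ 2 ^ n) ^ 2) Filter.atTop (nhds 1) := by
    simpa using (hc.comp ht).pow 2
  have hb : Filter.Tendsto (fun n : ℕ => thetaR (-q ^ 2 ^ n) ^ 2) Filter.atTop (nhds 1) := by
    have ht' := ht.neg
    rw [neg_zero] at ht'
    simpa using (hc.comp ht').pow 2
  have hpos : ∀ n : ℕ, 0 < thetaR (q ^ 2 ^ n) ^ 2 ∧ 0 < thetaR (-q ^ 2 ^ n) ^ 2 := fun n => by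
    have h1 := thetaR_ne_zero (hn n).1
    have h2 := thetaR_ne_zero (q := -q ^ 2 ^ n) (by rw [abs_neg]; exact (hn n).1)
    constructor <;> positivity
  -- The integral, constant along the iteration, lies between π/max and π/min of two sequences
  -- tending to 1.
  have hmin := (tendsto_const_nhds (x := Real.pi)).div (ha.min hb) (by simp)
  have hmax := (tendsto_const_nhds (x := Real.pi)).div (ha.max hb) (by simp)
  rw [min_self, div_one] at hmin
  rw [max_self, div_one] at hmax
  refine le_antisymm (ge_of_tendsto' hmin fun n => ?_) (le_of_tendsto' hmax fun n => ?_)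
  · rw [← (hn n).2]
    exact agmIntegral_le (hpos n).1 (hpos n).2
  · rw [← (hn n).2]
    exact le_agmIntegral (hpos n).1 (hpos n).2

lemma agmIntegral_mul {c : ℝ} (hc : 0 < c) (a b : ℝ) :
    agmIntegral (c * a) (c * b) = agmIntegral a b / c := by
  have h := MeasureTheory.Measure.integral_comp_div
    (fun t : ℝ => (√((t ^ 2 + a ^ 2) * (t ^ 2 + b ^ 2)))⁻¹) c
  rw [abs_of_pos hc, smul_eq_mul] at h
  have h2 : ∀ t : ℝ, (√((t ^ 2 + (c * a) ^ 2) * (t ^ 2 + (c * b) ^ 2)))⁻¹ =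
      (c ^ 2)⁻¹ * (√(((t / c) ^ 2 + a ^ 2) * ((t / c) ^ 2 + b ^ 2)))⁻¹ := fun t => by
    rw [← mul_inv, ← Real.sqrt_sq (sq_nonneg c), ← Real.sqrt_mul (by positivity)]
    congr 2
    field_simp
  rw [agmIntegral]
  simp_rw [h2]
  rw [MeasureTheory.integral_const_mul, h, agmIntegral]
  field_simp

/-! ### The lemniscatic integral and the value of Φ -/

lemma beta_eq_setIntegral {u v : ℝ} (hu : 0 < u) (hv : 0 < v) :
    ProbabilityTheory.beta u v =
      ∫ x in Set.Ioo (0 : ℝ) 1, x ^ (u - 1) * (1 - x) ^ (v - 1) := by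
  rw [ProbabilityTheory.beta_eq_betaIntegralReal u v hu hv, betaIntegral,
    intervalIntegral.integral_of_le zero_le_one, MeasureTheory.integral_Ioc_eq_integral_Ioo,
    MeasureTheory.setIntegral_congr_fun (g := fun x : ℝ =>
      ((x ^ (u - 1) * (1 - x) ^ (v - 1) : ℝ) : ℂ)) measurableSet_Ioo, integral_complex_ofReal]
  · exact ofReal_re _
  · intro x hx
    simp only
    push_cast [ofReal_cpow hx.1.le, ofReal_cpow (sub_pos.mpr hx.2).le]
    rfl

/-- Evaluation of the lemniscatic integral. -/
lemma two_mul_agmIntegral_sqrt_two :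
    2 * agmIntegral (√2) 1 = ProbabilityTheory.beta (1 / 4) (1 / 2) := by
  -- The substitution x = (t² + 1)⁻² turns the beta integral into the half-line form of the elliptic
  -- integral.
  have himg : (fun t : ℝ => ((t ^ 2 + 1) ^ 2)⁻¹) '' Set.Ioi 0 = Set.Ioo 0 1 := by
    ext r
    constructor
    · rintro ⟨t, ht, rfl⟩
      rw [Set.mem_Ioi] at ht
      refine ⟨by positivity, inv_lt_one_of_one_lt₀ (one_lt_pow₀ ?_ two_ne_zero)⟩
      have : 0 < t ^ 2 := by positivity
      linarith
    · rintro ⟨h0, h1⟩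
      have hs : 0 < √r := Real.sqrt_pos.mpr h0
      have hs1 : √r < 1 := by rw [Real.sqrt_lt' one_pos]; simpa using h1
      have h2 : 0 < (√r)⁻¹ - 1 := sub_pos.mpr ((one_lt_inv₀ hs).mpr hs1)
      refine ⟨√((√r)⁻¹ - 1), Real.sqrt_pos.mpr h2, ?_⟩
      simp only
      rw [Real.sq_sqrt h2.le, sub_add_cancel, inv_pow, Real.sq_sqrt h0.le, inv_inv]
  have hinj : Set.InjOn (fun t : ℝ => ((t ^ 2 + 1) ^ 2)⁻¹) (Set.Ioi 0) := by
    intro s hs t ht h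
    rw [Set.mem_Ioi] at hs ht
    simp only [inv_inj] at h
    rw [sq_eq_sq₀ (by positivity) (by positivity), add_left_inj, sq_eq_sq₀ hs.le ht.le] at h
    exact h
  have hder : ∀ t ∈ Set.Ioi (0 : ℝ), HasDerivWithinAt (fun t : ℝ => ((t ^ 2 + 1) ^ 2)⁻¹)
      (-(4 * t / (t ^ 2 + 1) ^ 3)) (Set.Ioi 0) t := by
    intro t _
    have h0 : (t ^ 2 + 1) ^ 2 ≠ 0 := by positivity
    have h := ((((hasDerivAt_id t).pow 2).add_const 1).pow 2).inv h0
    refine (h.congr_deriv ?_).hasDerivWithinAt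
    simp
    field_simp
    norm_num
    ring
  rw [beta_eq_setIntegral (by norm_num) (by norm_num), ← himg,
    MeasureTheory.integral_image_eq_integral_abs_deriv_smul measurableSet_Ioi hder hinj,
    agmIntegral_eq_two_mul, ← mul_assoc, ← MeasureTheory.integral_const_mul]
  refine MeasureTheory.setIntegral_congr_fun measurableSet_Ioi fun t ht => ?_
  rw [Set.mem_Ioi] at ht
  have hp : 0 < t ^ 2 + 1 := by positivity
  have h1 : (((t ^ 2 + 1) ^ 2)⁻¹ : ℝ) ^ ((1 / 4 : ℝ) - 1) = (t ^ 2 + 1) * √(t ^ 2 + 1) := by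
    rw [Real.inv_rpow (by positivity), ← Real.rpow_neg (by positivity), ← Real.rpow_natCast,
      ← Real.rpow_mul hp.le, Real.sqrt_eq_rpow]
    nth_rewrite 2 [← Real.rpow_one (t ^ 2 + 1)]
    rw [← Real.rpow_add hp]
    norm_num
  have h2 : (1 - ((t ^ 2 + 1) ^ 2)⁻¹ : ℝ) ^ ((1 / 2 : ℝ) - 1) =
      (t ^ 2 + 1) / (t * √(t ^ 2 + 2)) := by
    have e : (1 - ((t ^ 2 + 1) ^ 2)⁻¹ : ℝ) = (t / (t ^ 2 + 1)) ^ 2 * (t ^ 2 + 2) := by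
      field_simp
      ring
    rw [e, show (1 / 2 : ℝ) - 1 = -(1 / 2) by norm_num, Real.rpow_neg (by positivity),
      ← Real.sqrt_eq_rpow, Real.sqrt_mul (by positivity), Real.sqrt_sq (by positivity)]
    field_simp
  simp only [smul_eq_mul]
  rw [h1, h2, abs_neg, abs_of_pos (by positivity), Real.sq_sqrt (by norm_num), one_pow,
    Real.sqrt_mul (by positivity)]
  have h3 : 0 < √(t ^ 2 + 1) := Real.sqrt_pos.mpr hp
  have h4 : 0 < √(t ^ 2 + 2) := Real.sqrt_pos.mpr (by positivity)
  have h5 := Real.sq_sqrt hp.le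
  field_simp
  linear_combination -4 * h5

/-- The reflection formula Γ(1/4)Γ(3/4) = π√2 eliminates Γ(3/4). -/
lemma beta_quarter_half_pow :
    ProbabilityTheory.beta (1 / 4) (1 / 2) ^ 4 = Real.Gamma (1 / 4) ^ 8 / (4 * Real.pi ^ 2) := by
  have h := Real.Gamma_mul_Gamma_one_sub (1 / 4)
  rw [show Real.pi * (1 / 4) = Real.pi / 4 by ring, Real.sin_pi_div_four] at h
  have hg : Real.Gamma (1 / 4) ≠ 0 := (Real.Gamma_pos_of_pos (by norm_num)).ne'
  have hg' : Real.Gamma (3 / 4) ≠ 0 := (Real.Gamma_pos_of_pos (by norm_num)).ne'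
  have h2 : √2 ^ 4 = (4 : ℝ) := by
    rw [show √2 ^ 4 = (√2 ^ 2) ^ 2 by ring, Real.sq_sqrt (by norm_num)]; norm_num
  have h3 : √Real.pi ^ 4 = Real.pi ^ 2 := by
    rw [show √Real.pi ^ 4 = (√Real.pi ^ 2) ^ 2 by ring, Real.sq_sqrt Real.pi_pos.le]
  have h4 : (Real.Gamma (1 / 4) * Real.Gamma (3 / 4)) ^ 4 = 4 * Real.pi ^ 4 := by
    rw [show (3 / 4 : ℝ) = 1 - 1 / 4 by norm_num, h, div_pow, div_pow, h2]
    ring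
  rw [ProbabilityTheory.beta, Real.Gamma_one_half_eq, show (1 / 4 : ℝ) + 1 / 2 = 3 / 4 by norm_num,
    div_pow, mul_pow, h3, div_eq_div_iff (by positivity) (by positivity)]
  linear_combination -Real.Gamma (1 / 4) ^ 4 * h4

lemma PhiConst_eq : (PhiConst : ℂ) = Real.pi ^ 2 * theta3 1 ^ 8 / 8 := by
  set q : ℝ := Real.exp (-Real.pi) with hq
  have hq1 : |q| < 1 := by
    rw [abs_of_pos (Real.exp_pos _), Real.exp_lt_one_iff]
    linarith [Real.pi_pos]
  have hqn : diskNome 0 = q := by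
    rw [diskNome, hq]
    push_cast
    norm_num
  have h3 : theta3 1 = thetaR q := by
    rw [theta3_eq_thetaQ, ← thetaQ_ofReal, hq]
    push_cast
    norm_num
  have h := sigmaSq_zero_sq
  rw [sigmaSq, sigmaFourSq, hqn, ← ofReal_neg, thetaQ_ofReal, thetaQ_ofReal] at h
  norm_num at h
  norm_cast at h
  have hb : 0 < thetaR (-q) ^ 2 := by
    have := thetaR_ne_zero (q := -q) (by simpa using hq1)
    positivity
  -- At q = exp(-π) the pair (θ₃², θ₄²) is proportional to (√2, 1), so homogeneity reduces its
  -- integral to the lemniscatic one.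
  have ha : thetaR q ^ 2 = thetaR (-q) ^ 2 * √2 := by
    rw [← sq_eq_sq₀ (by positivity) (by positivity), h, mul_pow, Real.sq_sqrt (by norm_num)]
    ring
  have hJ := agmIntegral_thetaR hq1
  rw [ha] at hJ
  nth_rewrite 2 [← mul_one (thetaR (-q) ^ 2)] at hJ
  rw [agmIntegral_mul hb, div_eq_iff hb.ne'] at hJ
  have hB := beta_quarter_half_pow
  rw [← two_mul_agmIntegral_sqrt_two, hJ] at hB
  have h8 : thetaR q ^ 8 = 4 * (thetaR (-q) ^ 2) ^ 4 := by
    linear_combination (thetaR q ^ 4 + 2 * thetaR (-q) ^ 4) * h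
  have hfin : PhiConst = Real.pi ^ 2 * thetaR q ^ 8 / 8 := by
    rw [PhiConst, OmegaConst, h8]
    have hpi := Real.pi_pos
    field_simp at hB ⊢
    linear_combination -8 * hB
  rw [h3, hfin]
  push_cast
  ring

theorem mainTheorem5 :
    (∀ z : ℂ, ‖z‖ < 1 →
      HasSum (fun n : ℕ => theta3 1 *
        (dCoeff n / ((2 * n).factorial : ℂ) * (PhiConst : ℂ) ^ n * z ^ (2 * n))) (sigma3 z)) ∧
    ∀ n : ℕ, ∃ m : ℤ, dCoeff n = (m : ℂ) := by
  refine ⟨fun z hz => ?_, dCoeff_integral PhiConst_eq⟩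
  have ht := theta3_one_ne_zero
  have hP : (PhiConst : ℂ) ≠ 0 := by
    have hpi : (Real.pi : ℂ) ≠ 0 := by exact_mod_cast Real.pi_ne_zero
    rw [PhiConst_eq]
    exact div_ne_zero (mul_ne_zero (pow_ne_zero 2 hpi) (pow_ne_zero 8 ht)) (by norm_num)
  refine (hasSum_sigma3 hz).congr_fun fun n => ?_
  rw [dCoeff]
  field_simp
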